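/- **Setting.** Fix $N\ge 2$, $\beta\in[0,1)$ and $\alpha\in(0,1)$. There are $M$ bandits, of which $m=\alpha M$ (with $1\le m<M$) should be active per time slot. Bandit $i$ is attached to an irreducible aperiodic Markov chain on $[N]$ with row-stochastic transition matrix $\mathbf T^{(i)}$ and has a transmission success probability $\rho_i\in(0,1]$. Its state $X_i(t)$ is a belief (a probability row vector) in $\mathcal S^{(i)}=\{\text{rows of }(\mathbf T^{(i)})^n:\ n\ge1\}$. Under the passive action $u_i(t)=0$ it moves from $x$ to $x\mathbf T^{(i)}$. Under the active action $u_i(t)=1$ it moves, with probability $1-\rho_i$, to $x\mathbf T^{(i)}$ and, with probability $\rho_i$, to row $k$ of $\mathbf T^{(i)}$, where $k$ is drawn from $x$. Given the actions, the bandits move independently. The bandits are divided into $Q$ classes, where $Q$ is fixed; the $c$-th class has exactly $Mq_c$ bandits, where $q_c\in(0,1]$ are fixed with $\sum_c q_c=1$, and all chains of a class have the same transition matrix, which does not depend on $M$. The relaxed problem is to minimize $$E\Big[\sum_{t\ge1}\beta^{t-1}\sum_{i=1}^M H(X_i(t))\Big],\qquad H(x)=-\sum_k x_k\log_2x_k,$$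 over all (history-dependent, randomized, joint) policies with $$E\Big[\sum_{t\ge1}\beta^{t-1}\sum_{i=1}^M u_i(t)\Big]=\frac m{1-\beta}.$$ An optimal relaxed (OR) policy is an optimal policy of this problem that consists of one stationary (possibly randomized) decision rule for each bandit, applied independently of the other bandits. **Assumption 1.** The initial state $(X_1(1),\dots,X_M(1))$ follows the equilibrium distribution $\zeta$, on $\prod_i\mathcal S^{(i)}$, of the Markov chain governed by the OR policy; the bandits are mutually independent under $\zeta$. (The expectations in the relaxed problem are taken with this initial distribution.) **Proposition 1.** Suppose that, along a sequence of such systems with $M\to\infty$, Assumption 1 holds for each system and its OR policy. Let $y_t^{(M)}=\sum_{i=1}^M u_i(t)$ be the number of active bandits at time $t$ under the OR policy, and let $\Phi$ be the standard normal distribution function. Then for every positive integer $k$ and every $t\ge 1$, $$\liminf_{M\to\infty}\Pr\left\{\left|\frac{y_t^{(M)}}M-\frac mM\right|\le\frac k{\sqrt{4M}}\right\}\ \ge\ \Phi(k)-\Phi(-k).$$ If moreover the decision rule and the equilibrium distribution of a bandit depend only on its class (and not on $M$), then the limit of these probabilities exists, and it is at least $\Phi(k)-\Phi(-k)$. -/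

import Mathlib

noncomputable section

namespace UoI

/-! ### Discrete probability -/

/-- The law of a vector of `M` independent coordinates, the `i`-th one having law `p i`. -/
def prodPMF {A : Type*} : {M : ℕ} → (Fin M → PMF A) → PMF (Fin M → A)
  | 0, _ => PMF.pure Fin.elim0
  | _ + 1, p => (p 0).bind fun a =>
      (prodPMF fun i => p i.succ).map fun v => Fin.cons a v

/-- The mass of a vector under the product law is the product of the masses. -/
theorem prodPMF_apply {A : Type*} {M : ℕ} (p : Fin M → PMF A) (v : Fin M → A) :
    prodPMF p v = ∏ i, p i (v i) := by
  classical
  induction M with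
  | zero =>
    have hv : v = Fin.elim0 := Subsingleton.elim _ _
    subst hv
    simp [prodPMF]
  | succ M ih =>
    rw [prodPMF, PMF.bind_apply, tsum_eq_single (v 0)]
    · rw [PMF.map_apply, tsum_eq_single (fun i => v i.succ)]
      · have h : v = Fin.cons (v 0) (fun i => v i.succ) := (Fin.cons_self_tail v).symm
        rw [if_pos h, ih, Fin.prod_univ_succ]
      · intro w hw
        refine if_neg fun h => hw ?_
        funext i
        rw [h, Fin.cons_succ]
    · intro a ha
      rw [PMF.map_apply]
      refine mul_eq_zero_of_right _ (ENNReal.tsum_eq_zero.2 fun w => if_neg fun h => ha ?_)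
      rw [h, Fin.cons_zero]

/-- The expectation of a nonnegative function under a discrete law. -/
def expect {A : Type*} (p : PMF A) (f : A → ENNReal) : ENNReal := ∑' a, p a * f a

/-- The law of a binary variable which is `true` with probability `ρ`. -/
def coin (ρ : ℝ) (h0 : 0 < ρ) (h1 : ρ ≤ 1) : PMF Bool :=
  PMF.ofFintype (fun b => if b = true then ENNReal.ofReal ρ else ENNReal.ofReal (1 - ρ)) (by
    rw [Fintype.sum_bool, if_pos rfl, if_neg Bool.false_ne_true,
      ← ENNReal.ofReal_add h0.le (sub_nonneg.2 h1), add_sub_cancel, ENNReal.ofReal_one])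

/-! ### The remote Markov chains and the belief states -/

/-- An irreducible and aperiodic Markov chain on `N` states; `T j k` is the probability of
moving from state `j` to state `k`. -/
structure DTMC (N : ℕ) where
  T : Matrix (Fin N) (Fin N) ℝ
  stochastic : T ∈ Matrix.rowStochastic ℝ (Fin N)
  irreducible : ∀ j k, ∃ n : ℕ, 0 < (T ^ n) j k
  aperiodic : ∀ j, ∀ d : ℕ, (∀ n : ℕ, 1 ≤ n → 0 < (T ^ n) j j → d ∣ n) → d = 1

/-- A belief: a probability vector on the `N` states of a chain. -/
abbrev Belief (N : ℕ) : Type := stdSimplex ℝ (Fin N)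

/-- Shannon entropy in bits. -/
def entropy {N : ℕ} (x : Belief N) : ℝ := -∑ k, x.1 k * Real.logb 2 (x.1 k)

/-- A state of the chain drawn from a belief. -/
def Belief.law {N : ℕ} (x : Belief N) : PMF (Fin N) :=
  PMF.ofFintype (fun k => ENNReal.ofReal (x.1 k)) (by
    rw [← ENNReal.ofReal_sum_of_nonneg fun k _ => x.2.1 k, x.2.2, ENNReal.ofReal_one])

/-- The distribution of the chain `n` steps after it has been observed in state `k`. -/
def DTMC.row {N : ℕ} (D : DTMC N) (k : Fin N) (n : ℕ) : Belief N :=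
  ⟨(D.T ^ n) k,
    fun _ => Matrix.nonneg_of_mem_rowStochastic (pow_mem D.stochastic n),
    Matrix.sum_row_of_mem_rowStochastic (pow_mem D.stochastic n) k⟩

/-- The belief one time slot later when no observation is received. -/
def DTMC.push {N : ℕ} (D : DTMC N) (x : Belief N) : Belief N :=
  ⟨Matrix.vecMul x.1 D.T,
    Matrix.nonneg_vecMul_of_mem_rowStochastic D.stochastic x.2.1, by
    have h := Matrix.vecMul_dotProduct_one_eq_one_rowStochastic D.stochastic
      (x := x.1) (by rw [dotProduct_one]; exact x.2.2)
    rwa [dotProduct_one] at h⟩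

/-- The belief state space: all `n`-step transition distributions, `n ≥ 1`. -/
def DTMC.beliefSpace {N : ℕ} (D : DTMC N) : Set (Belief N) :=
  {x | ∃ (k : Fin N) (n : ℕ), 1 ≤ n ∧ x = D.row k n}

/-! ### The bandits -/

/-- `M` bandits: the `i`-th one is the belief process of the chain `chain i`, whose state is
received with probability `ρ i` in each time slot in which it is selected. -/
structure RMAB (M N : ℕ) where
  chain : Fin M → DTMC N
  ρ : Fin M → ℝ
  ρ_pos : ∀ i, 0 < ρ i
  ρ_le_one : ∀ i, ρ i ≤ 1

/-- The belief states of all bandits. -/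
abbrev State (M N : ℕ) : Type := Fin M → Belief N

/-- The actions applied to all bandits; `true` is the active action. -/
abbrev Action (M : ℕ) : Type := Fin M → Bool

/-- The number of bandits to which the active action is applied. -/
def activeCount {M : ℕ} (u : Action M) : ℕ := (Finset.univ.filter fun i => u i = true).card

namespace RMAB

variable {M N : ℕ}

/-- The state space of the bandits: the product of the belief state spaces. -/
def stateSpace (B : RMAB M N) : Set (State M N) := {s | ∀ i, s i ∈ (B.chain i).beliefSpace}

/-- One transition of bandit `i` from belief `x` under the action `a`. If the action is active
and the transmission succeeds, the state `k` of the chain, drawn from `x`, is observed and the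
next belief is the `k`-th row of the transition matrix; otherwise the belief is pushed forward. -/
def banditStep (B : RMAB M N) (i : Fin M) (x : Belief N) (a : Bool) : PMF (Belief N) :=
  if a = true then
    (coin (B.ρ i) (B.ρ_pos i) (B.ρ_le_one i)).bind fun received =>
      if received = true then x.law.map fun k => (B.chain i).row k 1
      else PMF.pure ((B.chain i).push x)
  else PMF.pure ((B.chain i).push x)

/-- One transition of all bandits: given the actions, they move independently. -/
def step (B : RMAB M N) (s : State M N) (u : Action M) : PMF (State M N) :=
  prodPMF fun i => B.banditStep i (s i) (u i)

end RMAB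

/-! ### Policies -/

/-- The past states and actions, the most recent ones first. -/
abbrev History (M N : ℕ) : Type := List (State M N × Action M)

/-- An admissible policy: it may depend on the whole past, act on the bandits jointly, and be
randomized. -/
abbrev Policy (M N : ℕ) : Type := History M N → State M N → PMF (Action M)

/-- One stationary (possibly randomized) decision rule for each bandit. -/
abbrev Rules (M N : ℕ) : Type := Fin M → Belief N → PMF Bool

/-- The policy that applies, in every time slot, each rule to its own bandit, independently of
the other bandits. -/
def Rules.toPolicy {M N : ℕ} (r : Rules M N) : Policy M N :=
  fun _ s => prodPMF fun i => r i (s i)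

namespace RMAB

variable {M N : ℕ}

/-- The joint law of the past and the current state after `t` time slots, when the initial
state has law `χ`. -/
def historyLaw (B : RMAB M N) (χ : PMF (State M N)) (p : Policy M N) :
    ℕ → PMF (History M N × State M N)
  | 0 => χ.map fun s => ([], s)
  | t + 1 => (B.historyLaw χ p t).bind fun hs =>
      (p hs.1 hs.2).bind fun u =>
        (B.step hs.2 u).map fun s' => ((hs.2, u) :: hs.1, s')

/-- The joint law of the state and the actions in time slot `t + 1`. -/
def stateActionLaw (B : RMAB M N) (χ : PMF (State M N)) (p : Policy M N) (t : ℕ) :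
    PMF (State M N × Action M) :=
  (B.historyLaw χ p t).bind fun hs => (p hs.1 hs.2).map fun u => (hs.2, u)

/-- The law of the number of active bandits in time slot `t + 1`. -/
def activeCountLaw (B : RMAB M N) (χ : PMF (State M N)) (p : Policy M N) (t : ℕ) : PMF ℕ :=
  (B.stateActionLaw χ p t).map fun su => activeCount su.2

/-- The expected total discounted entropy of the belief states. -/
def cost (B : RMAB M N) (β : ℝ) (χ : PMF (State M N)) (p : Policy M N) : ENNReal :=
  ∑' t : ℕ, ENNReal.ofReal (β ^ t) *
    expect (B.stateActionLaw χ p t) fun su => ENNReal.ofReal (∑ i, entropy (su.1 i))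

/-- The expected total discounted number of active actions. -/
def activation (B : RMAB M N) (β : ℝ) (χ : PMF (State M N)) (p : Policy M N) : ENNReal :=
  ∑' t : ℕ, ENNReal.ofReal (β ^ t) *
    expect (B.stateActionLaw χ p t) fun su => (activeCount su.2 : ENNReal)

/-- The constraint of the relaxed problem: in discounted expectation, `m` bandits are active
per time slot. -/
def RelaxedFeasible (B : RMAB M N) (β : ℝ) (m : ℕ) (χ : PMF (State M N)) (p : Policy M N) :
    Prop :=
  B.activation β χ p = ENNReal.ofReal (m / (1 - β))

/-- The policy solves the relaxed problem: it satisfies the relaxed constraint and has the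
least cost among all admissible policies that satisfy it. -/
def IsRelaxedOptimal (B : RMAB M N) (β : ℝ) (m : ℕ) (χ : PMF (State M N)) (p : Policy M N) :
    Prop :=
  B.RelaxedFeasible β m χ p ∧
    ∀ p' : Policy M N, B.RelaxedFeasible β m χ p' → B.cost β χ p ≤ B.cost β χ p'

/-- `ζ` is an equilibrium distribution of the Markov chain of all belief states governed by the
stationary rules `r`. -/
def IsEquilibrium (B : RMAB M N) (r : Rules M N) (ζ : PMF (State M N)) : Prop :=
  ζ.support ⊆ B.stateSpace ∧
    (ζ.bind fun s => (prodPMF fun i => r i (s i)).bind fun u => B.step s u) = ζ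

end RMAB

/-- The law of the state of bandit `i`. -/
def marginal {M N : ℕ} (ζ : PMF (State M N)) (i : Fin M) : PMF (Belief N) := ζ.map fun s => s i

/-- The states of the bandits are mutually independent under `ζ`. -/
def IndependentBandits {M N : ℕ} (ζ : PMF (State M N)) : Prop :=
  ζ = prodPMF fun i => marginal ζ i

/-- The cumulative distribution function of the standard normal distribution. -/
def Phi (x : ℝ) : ℝ := ProbabilityTheory.cdf (ProbabilityTheory.gaussianReal 0 1) x

/-- The probability that, in time slot `t + 1`, the proportion of active bandits differs from
`m / M` by at most `k / √(4 M)`, when the initial state has law `χ`. -/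
def RMAB.concentrationProb {M N : ℕ} (B : RMAB M N) (m : ℕ) (χ : PMF (State M N))
    (p : Policy M N) (t k : ℕ) : ℝ :=
  (B.activeCountLaw χ p t).toMeasure.real
    {y : ℕ | |(y : ℝ) / M - (m : ℝ) / M| ≤ (k : ℝ) / Real.sqrt (4 * M)}

end UoI

end

noncomputable section

namespace UoI

open MeasureTheory ProbabilityTheory Filter Topology

/-! ### Independent coordinates -/

/-! In equilibrium the belief states have law `ζ` in every time slot. Since the bandits are
independent under `ζ` and each rule reads only its own state, the actions in a slot are independent
binary variables whose success probabilities p_i do not depend on time. All terms of the discounted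
constraint then coincide, so the p_i sum to `m`: the count y is centered at exactly `m`. Hence (y -
m)/√M has mean 0 and variance V/M, the average of the p_i(1 - p_i), which lies in [0, 1/4]. The
event in question is |(y - m)/√M| ≤ k/2. Where V/M converges to v, characteristic functions give
convergence to N(0, v) (`tendsto_map_fluctuation`), and v ≤ 1/4 makes this limit at least as
concentrated as half a standard normal variable (`Phi_sub_le_gaussianReal`). In general V/M need not
converge; compactness of [0, 1/4] supplies subsequences, which suffice for the lower limit. With
class-dependent laws V/M is constant, so the whole sequence converges. -/

theorem prodPMF_bind {A C : Type*} {M : ℕ} (p : Fin M → PMF A) (f : Fin M → A → PMF C) :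
    ((prodPMF p).bind fun s => prodPMF fun i => f i (s i)) =
      prodPMF fun i => (p i).bind (f i) := by
  induction M with
  | zero => simp [prodPMF]
  | succ M ih =>
    simp only [prodPMF, ← ih, PMF.bind_bind, PMF.bind_map, Function.comp_def, Fin.cons_zero,
      Fin.cons_succ, PMF.map_bind]
    congr 1
    funext a
    -- The second-stage draw of the head and the first-stage draws of the tail appear in opposite
    -- orders on the two sides.
    rw [PMF.bind_comm]

theorem map_fun_id {A : Type*} (p : PMF A) : (p.map fun a => a) = p := PMF.map_id p

theorem expect_bind {A C : Type*} (p : PMF A) (g : A → PMF C) (f : C → ENNReal) :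
    expect (p.bind g) f = expect p fun a => expect (g a) f := by
  simp only [expect, PMF.bind_apply, ← ENNReal.tsum_mul_right, ← ENNReal.tsum_mul_left]
  rw [ENNReal.tsum_comm]
  simp only [mul_assoc]

theorem expect_pure {A : Type*} (a : A) (f : A → ENNReal) : expect (PMF.pure a) f = f a := by
  rw [expect, tsum_eq_single a]
  · simp
  · intro b hb
    simp [hb]

theorem expect_map {A C : Type*} (p : PMF A) (g : A → C) (f : C → ENNReal) :
    expect (p.map g) f = expect p fun a => f (g a) := by
  rw [← PMF.bind_pure_comp, expect_bind]
  simp [expect_pure]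

theorem expect_const_add {A : Type*} (p : PMF A) (x : ENNReal) (f : A → ENNReal) :
    (expect p fun a => x + f a) = x + expect p f := by
  simp [expect, mul_add, ENNReal.tsum_add, ENNReal.tsum_mul_right, PMF.tsum_coe]

theorem activeCount_eq_sum {M : ℕ} (u : Action M) :
    activeCount u = ∑ i, if u i = true then 1 else 0 := by
  rw [activeCount, Finset.card_filter]

theorem activeCount_cons {M : ℕ} (a : Bool) (u : Action M) :
    activeCount (M := M + 1) (Fin.cons a u) = (if a = true then 1 else 0) + activeCount u := by
  rw [activeCount_eq_sum, activeCount_eq_sum, Fin.sum_univ_succ]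
  simp only [Fin.cons_zero, Fin.cons_succ]

theorem expect_activeCount {M : ℕ} (b : Fin M → PMF Bool) :
    (expect (prodPMF b) fun u => (activeCount u : ENNReal)) = ∑ i, b i true := by
  induction M with
  | zero => simp [prodPMF, expect_pure, activeCount_eq_sum]
  | succ M ih =>
    simp only [prodPMF, expect_bind, expect_map, activeCount_cons, Nat.cast_add,
      expect_const_add, ih, Fin.sum_univ_succ]
    simp only [add_comm _ (∑ i : Fin M, b i.succ true), expect_const_add]
    simp [expect]

/-! ### The actions in equilibrium -/

namespace RMAB

variable {M N : ℕ} {B : RMAB M N} {r : Rules M N} {ζ : PMF (State M N)}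

/-- The policy ignores the past, so forgetting the history leaves a Markov chain on the states, for
which `ζ` is invariant. -/
theorem IsEquilibrium.map_snd_historyLaw (h : B.IsEquilibrium r ζ) (t : ℕ) :
    (B.historyLaw ζ r.toPolicy t).map Prod.snd = ζ := by
  induction t with
  | zero => simp [historyLaw, PMF.map_comp, Function.comp_def, map_fun_id]
  | succ t ih =>
    have h2 := h.2
    conv_rhs => rw [← h2, ← ih]
    simp [historyLaw, PMF.map_bind, PMF.map_comp, Function.comp_def, map_fun_id, PMF.bind_map,
      Rules.toPolicy]

theorem map_snd_stateActionLaw (B : RMAB M N) (χ : PMF (State M N)) (r : Rules M N) (t : ℕ) :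
    (B.stateActionLaw χ r.toPolicy t).map Prod.snd =
      ((B.historyLaw χ r.toPolicy t).map Prod.snd).bind fun s => prodPMF fun i => r i (s i) := by
  simp [stateActionLaw, PMF.map_bind, PMF.map_comp, Function.comp_def, map_fun_id, PMF.bind_map,
      Rules.toPolicy]

/-- The law of the action of bandit `i` when its state has the `i`-th marginal of `ζ`. -/
def actionLaw (r : Rules M N) (ζ : PMF (State M N)) (i : Fin M) : PMF Bool :=
  (marginal ζ i).bind (r i)

theorem IsEquilibrium.map_snd_stateActionLaw (h : B.IsEquilibrium r ζ)
    (hi : IndependentBandits ζ) (t : ℕ) :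
    (B.stateActionLaw ζ r.toPolicy t).map Prod.snd = prodPMF (actionLaw r ζ) := by
  rw [RMAB.map_snd_stateActionLaw, h.map_snd_historyLaw]
  conv_lhs => rw [hi]
  exact prodPMF_bind _ _

theorem IsEquilibrium.activeCountLaw_eq (h : B.IsEquilibrium r ζ)
    (hi : IndependentBandits ζ) (t : ℕ) :
    B.activeCountLaw ζ r.toPolicy t = (prodPMF (actionLaw r ζ)).map activeCount := by
  rw [← h.map_snd_stateActionLaw hi t, PMF.map_comp]
  rfl

/-- By stationarity the discounted activation is a geometric series times one expected count;
cancelling 1/(1 - β) from the constraint leaves that count. -/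
theorem IsEquilibrium.sum_actionLaw_eq (h : B.IsEquilibrium r ζ)
    (hi : IndependentBandits ζ) {β : ℝ} (hβ0 : 0 ≤ β) (hβ1 : β < 1) {m : ℕ}
    (hf : B.RelaxedFeasible β m ζ r.toPolicy) :
    ∑ i, (actionLaw r ζ i true).toReal = m := by
  have hE : ∀ t, (expect (B.stateActionLaw ζ r.toPolicy t) fun su =>
      (activeCount su.2 : ENNReal)) = ∑ i, actionLaw r ζ i true := by
    intro t
    rw [← expect_activeCount, ← h.map_snd_stateActionLaw hi t, expect_map]
  have hg : ∑' t : ℕ, ENNReal.ofReal (β ^ t) = ENNReal.ofReal (1 - β)⁻¹ := by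
    rw [← ENNReal.ofReal_tsum_of_nonneg (fun t => pow_nonneg hβ0 t)
      (summable_geometric_of_lt_one hβ0 hβ1), tsum_geometric_of_lt_one hβ0 hβ1]
  have hpos : 0 < (1 - β)⁻¹ := inv_pos.2 (sub_pos.2 hβ1)
  rw [RelaxedFeasible, activation] at hf
  simp only [hE, ENNReal.tsum_mul_right, hg] at hf
  have h' := congrArg ENNReal.toReal hf
  rw [ENNReal.toReal_mul, ENNReal.toReal_ofReal hpos.le,
    ENNReal.toReal_ofReal (by rw [div_eq_mul_inv]; positivity), div_eq_inv_mul,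
    ENNReal.toReal_sum fun i _ => PMF.apply_ne_top _ _] at h'
  exact mul_left_cancel₀ hpos.ne' h'

end RMAB

/-! ### The central limit theorem for sums of independent binary variables -/

/-- Exchange one factor at a time; the remaining factors lie in the unit disc and do not enlarge the
error. -/
theorem norm_prod_sub_prod_le {ι : Type*} (s : Finset ι) (f g : ι → ℂ)
    (hf : ∀ i ∈ s, ‖f i‖ ≤ 1) (hg : ∀ i ∈ s, ‖g i‖ ≤ 1) :
    ‖∏ i ∈ s, f i - ∏ i ∈ s, g i‖ ≤ ∑ i ∈ s, ‖f i - g i‖ := by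
  classical
  induction s using Finset.induction_on with
  | empty => simp
  | insert a s ha ih =>
    rw [Finset.prod_insert ha, Finset.prod_insert ha, Finset.sum_insert ha]
    have hfa := hf a (Finset.mem_insert_self _ _)
    have ih' := ih (fun i hi => hf i (Finset.mem_insert_of_mem hi))
      fun i hi => hg i (Finset.mem_insert_of_mem hi)
    have hgs : ‖∏ i ∈ s, g i‖ ≤ 1 := by
      rw [norm_prod]
      exact Finset.prod_le_one (fun _ _ => norm_nonneg _)
        fun i hi => hg i (Finset.mem_insert_of_mem hi)
    calc ‖f a * ∏ i ∈ s, f i - g a * ∏ i ∈ s, g i‖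
        = ‖f a * (∏ i ∈ s, f i - ∏ i ∈ s, g i) + (f a - g a) * ∏ i ∈ s, g i‖ := by
          congr 1; ring
      _ ≤ ‖f a‖ * ‖∏ i ∈ s, f i - ∏ i ∈ s, g i‖ + ‖f a - g a‖ * ‖∏ i ∈ s, g i‖ := by
          rw [← norm_mul, ← norm_mul]; exact norm_add_le _ _
      _ ≤ ‖f a - g a‖ + ∑ i ∈ s, ‖f i - g i‖ := by
          nlinarith [norm_nonneg (f a - g a), norm_nonneg (∏ i ∈ s, f i - ∏ i ∈ s, g i),
            mul_le_mul_of_nonneg_left hgs (norm_nonneg (f a - g a)),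
            mul_le_mul_of_nonneg_right hfa (norm_nonneg (∏ i ∈ s, f i - ∏ i ∈ s, g i))]

/-- The characteristic function of a centered binary variable of mean `p`. -/
def binaryCharFun (p s : ℝ) : ℂ :=
  p * Complex.exp ((s * (1 - p) : ℝ) * Complex.I) +
    (1 - p) * Complex.exp ((s * (0 - p) : ℝ) * Complex.I)

theorem norm_binaryCharFun_le {p : ℝ} (h0 : 0 ≤ p) (h1 : p ≤ 1) (s : ℝ) :
    ‖binaryCharFun p s‖ ≤ 1 := by
  refine (norm_add_le _ _).trans ?_
  rw [norm_mul, norm_mul, Complex.norm_exp_ofReal_mul_I, Complex.norm_exp_ofReal_mul_I,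
    ← Complex.ofReal_one, ← Complex.ofReal_sub, Complex.norm_real, Complex.norm_real,
    Real.norm_of_nonneg h0, Real.norm_of_nonneg (sub_nonneg.2 h1)]
  linarith

theorem norm_exp_mul_I_sub_le {x : ℝ} (hx : |x| ≤ 1) :
    ‖Complex.exp (x * Complex.I) - (1 + x * Complex.I - x ^ 2 / 2)‖ ≤ |x| ^ 3 := by
  have hn : ‖(x : ℂ) * Complex.I‖ = |x| := by simp
  have h := Complex.exp_bound (x := x * Complex.I) (hn.le.trans hx) (n := 3) (by norm_num)
  rw [hn] at h
  have he : ∑ j ∈ Finset.range 3, ((x : ℂ) * Complex.I) ^ j / (j.factorial : ℂ) =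
      1 + x * Complex.I - x ^ 2 / 2 := by
    simp [Finset.sum_range_succ, mul_pow, Nat.factorial]
    ring
  rw [he] at h
  refine h.trans ?_
  have : (0 : ℝ) ≤ |x| ^ 3 := by positivity
  norm_num [Nat.factorial]
  linarith

/-- Mean 0 and variance p(1 - p) make both functions agree to second order. The two Taylor errors,
weighted by p and 1 - p, contribute one |s|³ together, and the Gaussian factor contributes the
other. -/
theorem norm_binaryCharFun_sub_le {p s : ℝ} (h0 : 0 ≤ p) (h1 : p ≤ 1) (hs : |s| ≤ 1) :
    ‖binaryCharFun p s - Complex.exp ((-(p * (1 - p) * s ^ 2 / 2) : ℝ))‖ ≤ 2 * |s| ^ 3 := by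
  have hs0 := abs_nonneg s
  have key : ∀ a : ℝ, |a| ≤ 1 →
      ‖Complex.exp ((s * a : ℝ) * Complex.I) -
        (1 + (s * a : ℝ) * Complex.I - ((s * a : ℝ) : ℂ) ^ 2 / 2)‖ ≤ |s| ^ 3 := by
    intro a ha
    have hsa : |s * a| ≤ |s| := by
      rw [abs_mul]; exact mul_le_of_le_one_right hs0 ha
    exact (norm_exp_mul_I_sub_le (hsa.trans hs)).trans (by gcongr)
  have k1 := key (1 - p) (by rw [abs_le]; constructor <;> linarith)
  have k2 := key (0 - p) (by rw [abs_le]; constructor <;> linarith)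
  set y : ℝ := p * (1 - p) * s ^ 2 / 2 with hy
  have hpp : p * (1 - p) ≤ 1 := by nlinarith
  have hpp0 : 0 ≤ p * (1 - p) := mul_nonneg h0 (sub_nonneg.2 h1)
  have hs2 : s ^ 2 = |s| ^ 2 := (sq_abs s).symm
  have hy0 : 0 ≤ y := by positivity
  have hyle : y ≤ |s| ^ 2 := by
    rw [hy, hs2]; nlinarith [sq_nonneg |s|]
  have hy1 : y ≤ 1 := hyle.trans (pow_le_one₀ hs0 hs)
  -- The error is at most y² ≤ |s|⁴, which is below |s|³ because |s| ≤ 1.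
  have k3 : ‖Complex.exp ((-y : ℝ)) - (1 - y)‖ ≤ |s| ^ 3 := by
    have h := Real.abs_exp_sub_one_sub_id_le (x := -y) (by rwa [abs_neg, abs_of_nonneg hy0])
    have he : Complex.exp ((-y : ℝ)) - (1 - y) = ((Real.exp (-y) - 1 - -y : ℝ) : ℂ) := by
      push_cast; ring
    rw [he, Complex.norm_real]
    refine h.trans ?_
    calc (-y) ^ 2 = y * y := by ring
      _ ≤ |s| ^ 2 * |s| ^ 2 := by gcongr
      _ = |s| ^ 3 * |s| := by ring
      _ ≤ |s| ^ 3 := mul_le_of_le_one_right (by positivity) hs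
  set E1 := Complex.exp ((s * (1 - p) : ℝ) * Complex.I)
  set E2 := Complex.exp ((s * (0 - p) : ℝ) * Complex.I)
  have hdecomp : binaryCharFun p s - Complex.exp ((-y : ℝ)) =
      p * (E1 - (1 + (s * (1 - p) : ℝ) * Complex.I - ((s * (1 - p) : ℝ) : ℂ) ^ 2 / 2)) +
      ((1 - p : ℝ) : ℂ) *
        (E2 - (1 + (s * (0 - p) : ℝ) * Complex.I - ((s * (0 - p) : ℝ) : ℂ) ^ 2 / 2)) -
      (Complex.exp ((-y : ℝ)) - (1 - y)) := by
    have hE : binaryCharFun p s = p * E1 + (1 - p) * E2 := rfl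
    clear_value E1 E2
    rw [hE, hy]
    push_cast
    ring
  rw [hdecomp]
  refine (norm_sub_le _ _).trans ?_
  refine (add_le_add (norm_add_le _ _) k3).trans ?_
  rw [norm_mul, norm_mul, Complex.norm_real, Complex.norm_real, Real.norm_of_nonneg h0,
    Real.norm_of_nonneg (sub_nonneg.2 h1)]
  nlinarith [mul_le_mul_of_nonneg_left k1 h0, mul_le_mul_of_nonneg_left k2 (sub_nonneg.2 h1)]

theorem toReal_le_one {A : Type*} (p : PMF A) (a : A) : (p a).toReal ≤ 1 :=
  ENNReal.toReal_le_of_le_ofReal zero_le_one (by simpa using p.coe_le_one a)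

theorem toReal_false (b : PMF Bool) : (b false).toReal = 1 - (b true).toReal := by
  have h := b.tsum_coe
  rw [tsum_fintype, Fintype.sum_bool] at h
  have h' := congrArg ENNReal.toReal h
  rw [ENNReal.toReal_add (b.apply_ne_top _) (b.apply_ne_top _), ENNReal.toReal_one] at h'
  linarith

/-- The sum of the variances of the coordinates of a binary vector. -/
def sumVariance {M : ℕ} (b : Fin M → PMF Bool) : ℝ :=
  ∑ i, (b i true).toReal * (1 - (b i true).toReal)

/-- The centered and rescaled number of active bandits. -/
def fluctuation {M : ℕ} (m : ℕ) (u : Action M) : ℝ := ((activeCount u : ℝ) - m) / Real.sqrt M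

theorem charFun_fluctuation {M m : ℕ} (b : Fin M → PMF Bool)
    (hb : ∑ i, (b i true).toReal = m) (t : ℝ) :
    charFun ((prodPMF b).toMeasure.map (fluctuation m)) t =
      ∏ i, binaryCharFun (b i true).toReal (t / Real.sqrt M) := by
  have hmeas : Measurable (fluctuation m : Action M → ℝ) := measurable_of_finite _
  rw [charFun_apply_real, integral_map hmeas.aemeasurable
    (by fun_prop), PMF.integral_eq_sum]
  have hfac : ∀ i, binaryCharFun (b i true).toReal (t / Real.sqrt M) =
      ∑ a : Bool, ((b i a).toReal : ℂ) * Complex.exp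
        ((t / Real.sqrt M * ((if a = true then 1 else 0) - (b i true).toReal) : ℝ) *
          Complex.I) := by
    intro i
    rw [Fintype.sum_bool, toReal_false, binaryCharFun]
    simp
  simp only [hfac]
  -- Expanding the product of two-term sums gives a sum over all action vectors, that is, the
  -- expectation.
  rw [Finset.prod_univ_sum, Fintype.piFinset_univ]
  refine Finset.sum_congr rfl fun u _ => ?_
  rw [prodPMF_apply, ENNReal.toReal_prod, Finset.prod_mul_distrib, ← Complex.exp_sum,
    Complex.real_smul, Complex.ofReal_prod]
  congr 2
  rw [← Finset.sum_mul, ← Complex.ofReal_sum, ← Finset.mul_sum, Finset.sum_sub_distrib, hb,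
    fluctuation, activeCount_eq_sum]
  push_cast
  ring

/-- Each of the M factors, taken at s = t/√M, costs 2|t|³/M^(3/2). -/
theorem norm_charFun_fluctuation_sub_le {M m : ℕ} (hM : 0 < M) (b : Fin M → PMF Bool)
    (hb : ∑ i, (b i true).toReal = m) {t : ℝ} (ht : |t| / Real.sqrt M ≤ 1) :
    ‖charFun ((prodPMF b).toMeasure.map (fluctuation m)) t -
        Complex.exp ((-(sumVariance b / M * t ^ 2 / 2) : ℝ))‖ ≤
      2 * |t| ^ 3 / Real.sqrt M := by
  have hM' : (0 : ℝ) < M := Nat.cast_pos.2 hM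
  have hsq : 0 < Real.sqrt M := Real.sqrt_pos.2 hM'
  have hss : Real.sqrt M ^ 2 = M := Real.sq_sqrt hM'.le
  have habs : |t / Real.sqrt M| = |t| / Real.sqrt M := by rw [abs_div, abs_of_pos hsq]
  have hexp : Complex.exp ((-(sumVariance b / M * t ^ 2 / 2) : ℝ)) =
      ∏ i, Complex.exp ((-((b i true).toReal * (1 - (b i true).toReal) *
        (t / Real.sqrt M) ^ 2 / 2) : ℝ)) := by
    rw [← Complex.exp_sum, ← Complex.ofReal_sum, Finset.sum_neg_distrib, ← Finset.sum_div,
      ← Finset.sum_mul, div_pow, hss, sumVariance]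
    congr 3
    ring
  rw [charFun_fluctuation b hb, hexp]
  have h0 : ∀ i, 0 ≤ (b i true).toReal := fun i => ENNReal.toReal_nonneg
  have h1 : ∀ i, (b i true).toReal ≤ 1 := fun i => toReal_le_one _ _
  refine (norm_prod_sub_prod_le _ _ _ (fun i _ => norm_binaryCharFun_le (h0 i) (h1 i) _)
    fun i _ => ?_).trans ?_
  · rw [Complex.norm_exp_ofReal, Real.exp_le_one_iff]
    have := mul_nonneg (h0 i) (sub_nonneg.2 (h1 i))
    have : 0 ≤ (b i true).toReal * (1 - (b i true).toReal) * (t / Real.sqrt M) ^ 2 / 2 := by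
      positivity
    linarith
  · refine (Finset.sum_le_sum fun i _ =>
      norm_binaryCharFun_sub_le (h0 i) (h1 i) (habs.le.trans ht)).trans_eq ?_
    rw [Finset.sum_const, Finset.card_univ, Fintype.card_fin, nsmul_eq_mul, habs, div_pow]
    nth_rewrite 1 [← hss]
    field_simp

instance isProbabilityMeasure_map_fluctuation {M : ℕ} (m : ℕ) (b : Fin M → PMF Bool) :
    IsProbabilityMeasure ((prodPMF b).toMeasure.map (fluctuation m)) :=
  Measure.isProbabilityMeasure_map (measurable_of_finite _).aemeasurable

/-- **Central limit theorem** for rows of independent binary variables whose normalized variances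
converge, possibly to `0`. -/
theorem tendsto_map_fluctuation {M m : ℕ → ℕ} (hM : Tendsto M atTop atTop)
    (b : ∀ n, Fin (M n) → PMF Bool) (hb : ∀ n, ∑ i, (b n i true).toReal = m n) {v : NNReal}
    (hv : Tendsto (fun n => sumVariance (b n) / M n) atTop (𝓝 v)) :
    Tendsto (β := ProbabilityMeasure ℝ)
      (fun n => ⟨(prodPMF (b n)).toMeasure.map (fluctuation (m n)), inferInstance⟩) atTop
      (𝓝 ⟨gaussianReal 0 v, inferInstance⟩) := by
  refine ProbabilityMeasure.tendsto_iff_tendsto_charFun.2 fun t => ?_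
  have hsqrt : Tendsto (fun n => Real.sqrt (M n)) atTop atTop :=
    Real.tendsto_sqrt_atTop.comp (tendsto_natCast_atTop_atTop.comp hM)
  have hexp : Tendsto (fun n => Complex.exp ((-(sumVariance (b n) / M n * t ^ 2 / 2) : ℝ))) atTop
      (𝓝 (charFun (gaussianReal 0 v) t)) := by
    have he : charFun (gaussianReal 0 v) t = Complex.exp ((-((v : ℝ) * t ^ 2 / 2) : ℝ)) := by
      rw [charFun_gaussianReal]
      push_cast
      congr 1
      ring
    rw [he]
    have hc : Continuous fun x : ℝ => Complex.exp ((-(x * t ^ 2 / 2) : ℝ)) := by fun_prop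
    exact (hc.tendsto _).comp hv
  have hdiff : Tendsto (fun n => charFun ((prodPMF (b n)).toMeasure.map (fluctuation (m n))) t -
      Complex.exp ((-(sumVariance (b n) / M n * t ^ 2 / 2) : ℝ))) atTop (𝓝 0) := by
    refine squeeze_zero_norm' ?_ (hsqrt.const_div_atTop (2 * |t| ^ 3))
    -- The 1 in the maximum keeps √M positive even when t = 0.
    filter_upwards [hM.eventually_gt_atTop 0, hsqrt.eventually_ge_atTop (max |t| 1)] with n h1 h2
    refine norm_charFun_fluctuation_sub_le h1 (b n) (hb n) ?_
    rw [div_le_one (lt_of_lt_of_le (by positivity) h2)]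
    exact (le_max_left _ _).trans h2
  simpa using hdiff.add hexp

/-- For v = 0 the law is the Dirac mass at 0, which misses ±a only because a > 0. -/
theorem gaussianReal_frontier_Icc {a : ℝ} (ha : 0 < a) (v : NNReal) :
    gaussianReal 0 v (frontier (Set.Icc (-a) a)) = 0 := by
  rw [frontier_Icc (by linarith)]
  by_cases hv : v = 0
  · subst hv
    rw [gaussianReal_zero_var, Measure.dirac_apply' _ (Set.toFinite _).measurableSet,
      Set.indicator_of_notMem]
    simp [ha.ne, ha.ne']
  · have := nullSingletonClass_gaussianReal (μ := 0) hv
    exact (Set.toFinite _).measure_zero _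

theorem tendsto_real_fluctuation {M m : ℕ → ℕ} (hM : Tendsto M atTop atTop)
    (b : ∀ n, Fin (M n) → PMF Bool) (hb : ∀ n, ∑ i, (b n i true).toReal = m n) {v : NNReal}
    (hv : Tendsto (fun n => sumVariance (b n) / M n) atTop (𝓝 v)) {a : ℝ} (ha : 0 < a) :
    Tendsto (fun n => ((prodPMF (b n)).toMeasure.map (fluctuation (m n))).real (Set.Icc (-a) a))
      atTop (𝓝 ((gaussianReal 0 v).real (Set.Icc (-a) a))) :=
  (ENNReal.tendsto_toReal (measure_ne_top _ _)).comp
    (ProbabilityMeasure.tendsto_measure_of_null_frontier_of_tendsto'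
      (tendsto_map_fluctuation hM b hb hv) (gaussianReal_frontier_Icc ha v))

/-- A centered normal variable of variance at most `1 / 4` is at least as concentrated as half a
standard normal variable. -/
theorem Phi_sub_le_gaussianReal {v : NNReal} (hv : (v : ℝ) ≤ 1 / 4) {x : ℝ} (hx : 0 ≤ x) :
    Phi x - Phi (-x) ≤ (gaussianReal 0 v).real (Set.Icc (-(x / 2)) (x / 2)) := by
  -- Scaling a standard normal variable by √v also covers the degenerate case v = 0.
  have hmap : gaussianReal 0 v = (gaussianReal 0 1).map (Real.sqrt v * ·) := by
    rw [gaussianReal_map_const_mul, mul_zero]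
    congr 1
    ext
    simp
  have hs : Real.sqrt v ≤ 1 / 2 := by
    rw [Real.sqrt_le_left (by norm_num)]
    linarith
  have hdiff : Phi x - Phi (-x) = (gaussianReal 0 1).real (Set.Ioc (-x) x) := by
    rw [Phi, Phi, cdf_eq_real, cdf_eq_real, ← Set.Iic_sdiff_Iic,
      measureReal_sdiff (Set.Iic_subset_Iic.2 (by linarith)) measurableSet_Iic]
  rw [hdiff, hmap, map_measureReal_apply (by fun_prop) measurableSet_Icc]
  refine measureReal_mono fun y hy => ?_
  have hy' : |y| ≤ x := abs_le.2 ⟨hy.1.le, hy.2⟩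
  have : |Real.sqrt v * y| ≤ x / 2 := by
    rw [abs_mul, abs_of_nonneg (Real.sqrt_nonneg _)]
    nlinarith [abs_nonneg y, mul_le_mul hs hy' (abs_nonneg y) (by norm_num)]
  exact abs_le.1 this

theorem sumVariance_nonneg {M : ℕ} (b : Fin M → PMF Bool) : 0 ≤ sumVariance b :=
  Finset.sum_nonneg fun _ _ =>
    mul_nonneg ENNReal.toReal_nonneg (sub_nonneg.2 (toReal_le_one _ _))

theorem sumVariance_div_le {M : ℕ} (b : Fin M → PMF Bool) : sumVariance b / M ≤ 1 / 4 := by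
  have h : sumVariance b ≤ ∑ _i : Fin M, (1 / 4 : ℝ) :=
    Finset.sum_le_sum fun i _ => by nlinarith [sq_nonneg ((b i true).toReal - 1 / 2)]
  rw [Finset.sum_const, Finset.card_univ, Fintype.card_fin, nsmul_eq_mul] at h
  exact div_le_of_le_mul₀ (Nat.cast_nonneg _) (by norm_num) (by linarith)

/-! ### The concentration probability -/

/-- Since √(4M) = 2√M, multiplying the deviation by √M turns the threshold into k/2. -/
theorem RMAB.IsEquilibrium.concentrationProb_eq {M N : ℕ} {B : RMAB M N} {r : Rules M N}
    {ζ : PMF (State M N)} (h : B.IsEquilibrium r ζ) (hi : IndependentBandits ζ) (hM : 0 < M)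
    (m t k : ℕ) :
    B.concentrationProb m ζ r.toPolicy t k =
      ((prodPMF (RMAB.actionLaw r ζ)).toMeasure.map (fluctuation m)).real
        (Set.Icc (-((k : ℝ) / 2)) (k / 2)) := by
  have hM' : (0 : ℝ) < M := Nat.cast_pos.2 hM
  have hsq : 0 < Real.sqrt M := Real.sqrt_pos.2 hM'
  rw [RMAB.concentrationProb, h.activeCountLaw_eq hi,
    ← PMF.toMeasure_map (hf := measurable_of_finite _),
    map_measureReal_apply (measurable_of_finite _) (Set.to_countable _).measurableSet,
    map_measureReal_apply (measurable_of_finite _) measurableSet_Icc]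
  congr 1
  ext u
  have h4 : Real.sqrt (4 * M) = 2 * Real.sqrt M := by
    rw [Real.sqrt_mul (by norm_num), show (4 : ℝ) = 2 ^ 2 by norm_num,
      Real.sqrt_sq (by norm_num)]
  have hss : Real.sqrt M * Real.sqrt M = M := Real.mul_self_sqrt hM'.le
  have hl : (activeCount u : ℝ) / M - (m : ℝ) / M = fluctuation m u / Real.sqrt M := by
    rw [fluctuation, div_div, hss, sub_div]
  simp only [Set.mem_preimage, Set.mem_ofPred_eq, Set.mem_Icc]
  rw [hl, h4, abs_div, abs_of_pos hsq, ← div_div, div_le_div_iff_of_pos_right hsq, abs_le]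

/-- If the laws of the coordinates depend only on their class, the normalized variance depends
only on the proportions of the classes. -/
theorem sumVariance_div_eq_of_class {M Q : ℕ} (hM : 0 < M) {q : Fin Q → ℝ} {cls : Fin M → Fin Q}
    (hcls : ∀ c, ((Finset.univ.filter fun i => cls i = c).card : ℝ) = M * q c)
    (b : Fin M → PMF Bool) (b₀ : Fin Q → PMF Bool) (hb : ∀ i, b i = b₀ (cls i)) :
    sumVariance b / M = ∑ c, q c * ((b₀ c true).toReal * (1 - (b₀ c true).toReal)) := by
  have hM' : (M : ℝ) ≠ 0 := Nat.cast_ne_zero.2 hM.ne'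
  rw [sumVariance, ← Finset.sum_fiberwise (g := cls), Finset.sum_div]
  refine Finset.sum_congr rfl fun c _ => ?_
  rw [Finset.sum_congr rfl (g := fun _ => (b₀ c true).toReal * (1 - (b₀ c true).toReal)),
    Finset.sum_const, nsmul_eq_mul, hcls]
  · field_simp
  · intro i hi
    rw [hb, (Finset.mem_filter.1 hi).2]

theorem Phi_sub_le_liminf_fluctuation {M m : ℕ → ℕ} (hM : Tendsto M atTop atTop)
    (b : ∀ n, Fin (M n) → PMF Bool) (hb : ∀ n, ∑ i, (b n i true).toReal = m n)
    {x : ℝ} (hx : 0 < x) :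
    Phi x - Phi (-x) ≤ liminf (fun n => ((prodPMF (b n)).toMeasure.map (fluctuation (m n))).real
      (Set.Icc (-(x / 2)) (x / 2))) atTop := by
  refine le_of_forall_lt fun c hc => ?_
  obtain ⟨d, hcd, hd⟩ := exists_between hc
  refine hcd.trans_le (le_liminf_of_le ?_ ?_)
  -- The lower limit of a real sequence is meaningful only with such a bound; here probabilities are
  -- at most 1.
  · exact (isBoundedUnder_of ⟨1, fun n => measureReal_le_one⟩).isCoboundedUnder_ge
  by_contra hfreq
  obtain ⟨φ, hφ, hlt⟩ := extraction_of_frequently_atTop (not_eventually.1 hfreq)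
  -- Along a subsequence with all probabilities below d, a further one has convergent variances; its
  -- limiting probability is at most d, yet at least Φ(x) - Φ(-x) > d.
  obtain ⟨v, hv, ψ, hψ, hlim⟩ := (isCompact_Icc (a := (0 : ℝ)) (b := 1 / 4)).tendsto_subseq
    (x := fun n => sumVariance (b (φ n)) / M (φ n)) fun n =>
      ⟨div_nonneg (sumVariance_nonneg _) (Nat.cast_nonneg _), sumVariance_div_le _⟩
  have hsub : Tendsto (fun n => φ (ψ n)) atTop atTop := (hφ.comp hψ).tendsto_atTop
  lift v to NNReal using hv.1
  have hconv := tendsto_real_fluctuation (hM.comp hsub) (fun n => b (φ (ψ n)))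
    (fun n => hb (φ (ψ n))) hlim (half_pos hx)
  have hle := le_of_tendsto' hconv fun n => (not_le.1 (hlt (ψ n))).le
  exact absurd ((Phi_sub_le_gaussianReal hv.2 hx.le).trans hle) (not_le.2 hd)

end UoI

end

theorem proposition1 (N Q : ℕ) (hN : 2 ≤ N) (β : ℝ) (hβ0 : 0 ≤ β) (hβ1 : β < 1)
    -- the classes, their proportions, and the fixed proportion of channels
    (D : Fin Q → UoI.DTMC N) (q : Fin Q → ℝ) (hq : ∀ c, 0 < q c ∧ q c ≤ 1)
    (hqsum : ∑ c, q c = 1) (α : ℝ)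
    -- a sequence of systems with more and more bandits
    (M m : ℕ → ℕ) (hM : Filter.Tendsto M Filter.atTop Filter.atTop)
    (hm : ∀ n, 1 ≤ m n ∧ m n < M n) (hα : ∀ n, (m n : ℝ) / M n = α)
    (B : ∀ n, UoI.RMAB (M n) N) (cls : ∀ n, Fin (M n) → Fin Q)
    (hcls : ∀ n c, ((Finset.univ.filter fun i => cls n i = c).card : ℝ) = M n * q c)
    (hB : ∀ n i, (B n).chain i = D (cls n i))
    -- the optimal relaxed policy, started from its equilibrium distribution
    (r : ∀ n, UoI.Rules (M n) N) (ζ : ∀ n, PMF (UoI.State (M n) N))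
    (hOR : ∀ n, (B n).IsRelaxedOptimal β (m n) (ζ n) (r n).toPolicy)
    (hζ : ∀ n, (B n).IsEquilibrium (r n) (ζ n))
    (hind : ∀ n, UoI.IndependentBandits (ζ n))
    (k : ℕ) (hk : 1 ≤ k) (t : ℕ) :
    UoI.Phi k - UoI.Phi (-k) ≤
        Filter.liminf (fun n => (B n).concentrationProb (m n) (ζ n) (r n).toPolicy t k)
          Filter.atTop ∧
      -- the limit exists if rules and equilibrium laws depend only on the class of the bandit
      ((∃ (r₀ : Fin Q → UoI.Belief N → PMF Bool) (ζ₀ : Fin Q → PMF (UoI.Belief N)),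
          ∀ n i, r n i = r₀ (cls n i) ∧ UoI.marginal (ζ n) i = ζ₀ (cls n i)) →
        ∃ L : ℝ, Filter.Tendsto
            (fun n => (B n).concentrationProb (m n) (ζ n) (r n).toPolicy t k)
            Filter.atTop (nhds L) ∧
          UoI.Phi k - UoI.Phi (-k) ≤ L) := by
  have hMpos : ∀ n, 0 < M n := fun n => (Nat.zero_le _).trans_lt (hm n).2
  have hk' : (0 : ℝ) < k := Nat.cast_pos.2 hk
  set b : ∀ n, Fin (M n) → PMF Bool := fun n => UoI.RMAB.actionLaw (r n) (ζ n) with hbdef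
  have hb : ∀ n, ∑ i, (b n i true).toReal = m n := fun n =>
    (hζ n).sum_actionLaw_eq (hind n) hβ0 hβ1 (hOR n).1
  simp only [fun n => (hζ n).concentrationProb_eq (hind n) (hMpos n) (m n) t k]
  refine ⟨UoI.Phi_sub_le_liminf_fluctuation hM b hb hk', ?_⟩
  rintro ⟨r₀, ζ₀, h⟩
  have hb₀ : ∀ n i, b n i = (ζ₀ (cls n i)).bind (r₀ (cls n i)) := fun n i => by
    simp only [hbdef, UoI.RMAB.actionLaw, (h n i).1, (h n i).2]
  have hvar := fun n => UoI.sumVariance_div_eq_of_class (hMpos n) (hcls n) (b n)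
    (fun c => (ζ₀ c).bind (r₀ c)) (hb₀ n)
  set v := ∑ c, q c * (((ζ₀ c).bind (r₀ c) true).toReal *
    (1 - ((ζ₀ c).bind (r₀ c) true).toReal))
  have hv0 : 0 ≤ v := hvar 0 ▸ div_nonneg (UoI.sumVariance_nonneg _) (Nat.cast_nonneg _)
  have hv1 : v ≤ 1 / 4 := hvar 0 ▸ UoI.sumVariance_div_le _
  clear_value v
  lift v to NNReal using hv0
  refine ⟨_, UoI.tendsto_real_fluctuation hM b hb (v := v) ?_ (half_pos hk'),
    UoI.Phi_sub_le_gaussianReal hv1 hk'.le⟩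
  simp only [hvar]
  exact tendsto_const_nhds
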